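/- Let $F:\mathbb R\to\mathbb C$ be twice continuously differentiable with $F,F',F''\in L^1(\mathbb R)$ (that is, $F\in C^2(\mathbb R)\cap W^{2,1}(\mathbb R)$), and suppose that $F(x)=e^{-x}$ for all $x\ge 0$. Put $\Phi=F+F'$ and, for $z\in\mathbb C$ with $\operatorname{Im} z\le 0$, $$f(z)=\frac1{2\pi}\int_{-\infty}^{\infty}\Phi(x)\,e^{izx}\,dx .$$ Then: 1. the integral defining $f(z)$ converges absolutely whenever $\operatorname{Im} z\le 0$; $f$ is continuous on $\{\operatorname{Im} z\le 0\}$ and analytic on $\{\operatorname{Im} z<0\}$; 2. there is a constant $C$ such that $|z|\,|f(z)|\le C$ whenever $\operatorname{Im} z\le 0$; 3. $k\mapsto \frac{f(k)}{1-ik}$ is integrable on $\mathbb R$ and $\int_{\mathbb R}\frac{f(k)}{1-ik}\,dk=1$; 4. for every $N$, every $t\ge 0$ and every matrix function $A$ with values in $\mathbb C^{N\times N}$ that is (Lebesgue) integrable on $[0,t]$, with Cartesian decomposition $A(s)=L(s)+iH(s)$, $L=\frac{A+A^\dagger}{2}$, $H=\frac{A-A^\dagger}{2i}$, if $L(s)\succeq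 0$ for all $0\le s\le t$, then $$\mathcal T e^{-\int_0^t A(s)\,ds}=\int_{\mathbb R}\frac{f(k)}{1-ik}\;\mathcal T e^{-i\int_0^t (kL(s)+H(s))\,ds}\,dk ,$$ where the integral on the right converges absolutely. Here $\mathcal T e^{\int_0^t G(s)\,ds}=\sum_{n\ge 0}\int_{t\ge s_1\ge\cdots\ge s_n\ge 0}G(s_1)\cdots G(s_n)\,ds_n\cdots ds_1$ denotes the time-ordered exponential (Dyson series), with the $n=0$ term equal to the identity matrix; it is the evolution operator from time $0$ to time $t$ of $u'=Gu$. -/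

import Mathlib

open MeasureTheory
open scoped Matrix.Norms.L2Operator ComplexOrder

noncomputable section

/-- The generating function `Φ = F + F'`. -/
def generatingFun (F : ℝ → ℂ) (x : ℝ) : ℂ := F x + deriv F x

/-- The kernel function `f(z) = (1 / 2π) ∫ Φ(x) e^{izx} dx`, the inverse Fourier transform of `Φ`.
It is meant for `Im z ≤ 0`, the only range in which its values are used. -/
def kernelFun (F : ℝ → ℂ) (z : ℂ) : ℂ :=
  1 / (2 * (Real.pi : ℂ)) * ∫ x : ℝ, generatingFun F x * Complex.exp (Complex.I * z * (x : ℂ))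

/-- The weight `f(k) / (1 - i k)` on the real axis. -/
def lchsWeight (F : ℝ → ℂ) (k : ℝ) : ℂ :=
  kernelFun F (k : ℂ) / (1 - Complex.I * (k : ℂ))

/-- The Hermitian real part `L = (A + A†) / 2` of the Cartesian decomposition `A = L + iH`. -/
def cartesianRe {N : ℕ} (A : Matrix (Fin N) (Fin N) ℂ) : Matrix (Fin N) (Fin N) ℂ :=
  (1 / 2 : ℂ) • (A + A.conjTranspose)

/-- The Hermitian imaginary part `H = (A - A†) / (2i)` of the Cartesian decomposition
`A = L + iH`. -/
def cartesianIm {N : ℕ} (A : Matrix (Fin N) (Fin N) ℂ) : Matrix (Fin N) (Fin N) ℂ :=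
  (1 / (2 * Complex.I) : ℂ) • (A - A.conjTranspose)

/-- The `n`-th term of the Dyson series of `G`, namely the integral of `G(s₁) G(s₂) ⋯ G(sₙ)` over
`t ≥ s₁ ≥ s₂ ≥ ⋯ ≥ sₙ ≥ 0`, written as an iterated integral. -/
def dysonTerm {N : ℕ} (G : ℝ → Matrix (Fin N) (Fin N) ℂ) : ℕ → ℝ → Matrix (Fin N) (Fin N) ℂ
  | 0, _ => 1
  | n + 1, t => ∫ s in (0 : ℝ)..t, G s * dysonTerm G n s

/-- The time-ordered exponential `𝒯 exp(∫₀ᵗ G(s) ds)`, as the sum of the Dyson series. The series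
converges absolutely when `G` is integrable on `[0, t]`, and its sum is then the evolution operator
from time `0` to time `t` of the equation `u' = G u`. -/
def timeOrderedExp {N : ℕ} (G : ℝ → Matrix (Fin N) (Fin N) ℂ) (t : ℝ) :
    Matrix (Fin N) (Fin N) ℂ :=
  ∑' n : ℕ, dysonTerm G n t

/-- `𝒯 exp(-i ∫₀ᵗ (k L(s) + H(s)) ds)`, where `A = L + iH` is the Cartesian decomposition. -/
def hamiltonianEvolution {N : ℕ} (A : ℝ → Matrix (Fin N) (Fin N) ℂ) (k t : ℝ) :
    Matrix (Fin N) (Fin N) ℂ :=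
  timeOrderedExp (fun s => (-Complex.I) • ((k : ℂ) • cartesianRe (A s) + cartesianIm (A s))) t

end

/-!
The identity is the residue theorem at the single pole `z = -i` of `f(z) / (1 - i z)` in the lower
half-plane. For complex `z` let `U(z)` be the evolution generated by `-i (z L + H)`. At `z = -i` this
generator is `-(L + i H) = -A`, so `U(-i)` is the left-hand side of the identity. Three facts about
`U` are needed. It is entire, because along an affine family of generators every term of the Dyson
series is a polynomial in the parameter and the series converges locally uniformly
(`differentiable_timeOrderedExp_affine`). It satisfies `‖U(z)‖ ≤ 1` for `Im z ≤ 0`, because the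
Hermitian part of the generator is then `(Im z) L ≤ 0` (`norm_timeOrderedExp_le_one`). It needs no
decay, because `f` provides it.

As `F(x) = e^{-x}` for `x ≥ 0`, the function `Φ = F + F'` vanishes on the positive half-line, and
`|e^{izx}| ≤ 1` for `x ≤ 0` and `Im z ≤ 0`. Hence `f` is bounded and continuous on the closed lower
half-plane and holomorphic inside, and one integration by parts gives `f(z) = O(1 / |z|)`. With
`f(-i) = (1 / 2π) ∫_{-∞}^0 (F e^x)' dx = F(0) / 2π = 1 / 2π` (`kernelFun_neg_I`), the Cauchy formula
`integrable_and_integral_inv_one_sub_I_mul_smul`,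
`∫ h(k) / (1 - i k) dk = 2π h(-i)` for `h(z) = O(1 / |z|)`, gives the normalization when `h = f` and
the identity when `h = f U`.

The generator is merely integrable in time, so the evolution is absolutely continuous rather than
differentiable: the factorial bound on the Dyson terms and the energy estimate
`d/ds ‖U v‖² = 2 Re ⟪U v, G U v⟫` use the fundamental theorem of calculus for absolutely continuous
functions.
-/

open Set Filter Topology

/-! ### Absolutely continuous primitives -/

section Primitive

open intervalIntegral

lemma AbsolutelyContinuousOnInterval.of_dist_le {X Y : Type*} [PseudoMetricSpace X]
    [PseudoMetricSpace Y] {f : ℝ → X} {g : ℝ → Y} {a b : ℝ}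
    (hg : AbsolutelyContinuousOnInterval g a b)
    (h : ∀ x ∈ uIcc a b, ∀ y ∈ uIcc a b, dist (f x) (f y) ≤ dist (g x) (g y)) :
    AbsolutelyContinuousOnInterval f a b := by
  rw [absolutelyContinuousOnInterval_iff] at hg ⊢
  intro ε hε
  obtain ⟨δ, hδ, H⟩ := hg ε hε
  refine ⟨δ, hδ, fun E hE hlt => lt_of_le_of_lt (Finset.sum_le_sum fun i hi => ?_) (H E hE hlt)⟩
  exact h _ (hE.1 i hi).1 _ (hE.1 i hi).2

lemma intervalIntegrable_sub_interval {E : Type*} [NormedAddCommGroup E] {g : ℝ → E} {T : ℝ}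
    (hg : IntervalIntegrable g volume 0 T) {x y : ℝ} (hx : x ∈ uIcc 0 T) (hy : y ∈ uIcc 0 T) :
    IntervalIntegrable g volume x y :=
  hg.mono_set (uIcc_subset_uIcc hx hy)

lemma IntervalIntegrable.absolutelyContinuousOnInterval_primitive {E : Type*}
    [NormedAddCommGroup E] [NormedSpace ℝ E] {g : ℝ → E} {T : ℝ}
    (hg : IntervalIntegrable g volume 0 T) :
    AbsolutelyContinuousOnInterval (fun x => ∫ s in (0 : ℝ)..x, g s) 0 T := by
  have h := hg.norm.absolutelyContinuousOnInterval_intervalIntegral (c := 0) left_mem_uIcc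
  refine h.of_dist_le fun x hx y hy => ?_
  have h0 : (0 : ℝ) ∈ uIcc 0 T := left_mem_uIcc
  have hg' {u v} (hu) (hv) := intervalIntegrable_sub_interval (x := u) (y := v) hg hu hv
  rw [dist_eq_norm, dist_eq_norm,
    integral_interval_sub_left (hg' h0 hx) (hg' h0 hy),
    integral_interval_sub_left (hg' h0 hx).norm (hg' h0 hy).norm]
  exact norm_integral_le_abs_integral_norm

/-- The antiderivative of `g γⁿ`, where `γ` is the primitive of a merely integrable `g`. -/
lemma integral_mul_primitive_pow {g : ℝ → ℝ} {T : ℝ} (hg : IntervalIntegrable g volume 0 T)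
    (n : ℕ) :
    ∫ s in (0 : ℝ)..T, g s * (∫ r in (0 : ℝ)..s, g r) ^ n
      = (∫ r in (0 : ℝ)..T, g r) ^ (n + 1) / (n + 1) := by
  have hac := hg.absolutelyContinuousOnInterval_primitive
  have hpow : ∀ m : ℕ, AbsolutelyContinuousOnInterval
      (fun x => (∫ s in (0 : ℝ)..x, g s) ^ (m + 1)) 0 T := by
    intro m
    induction m with
    | zero => simpa using hac
    | succ m ih => simpa only [pow_succ _ (m + 1)] using ih.fun_mul hac
  have h1 := (hpow n).integral_deriv_eq_sub
  have h2 : ∫ s in (0 : ℝ)..T, deriv (fun x => (∫ s in (0 : ℝ)..x, g s) ^ (n + 1)) s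
      = ∫ s in (0 : ℝ)..T, (n + 1) * (g s * (∫ r in (0 : ℝ)..s, g r) ^ n) := by
    apply intervalIntegral.integral_congr_ae
    filter_upwards [hg.ae_hasDerivAt_integral] with x hx hxm
    have := (hx (uIoc_subset_uIcc hxm) 0 left_mem_uIcc).fun_pow (n + 1)
    rw [HasDerivAt.deriv this]
    push_cast
    ring
  rw [h2, intervalIntegral.integral_const_mul] at h1
  rw [eq_div_iff (by positivity)]
  simp at h1
  linarith

end Primitive

/-! ### The Dyson series of an integrable generator -/

section Dyson

open intervalIntegral

variable {N : ℕ} {G : ℝ → Matrix (Fin N) (Fin N) ℂ} {T : ℝ}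

/-- Only an inequality, since the norm vanishes on matrices of size `0`. -/
lemma norm_one_matrix_le (N : ℕ) : ‖(1 : Matrix (Fin N) (Fin N) ℂ)‖ ≤ 1 := by
  rw [Matrix.l2_opNorm_def]
  refine ContinuousLinearMap.opNorm_le_bound _ zero_le_one fun v => ?_
  simp

lemma continuousOn_dysonTerm (hG : IntervalIntegrable G volume 0 T) (n : ℕ) :
    ContinuousOn (dysonTerm G n) (uIcc 0 T) := by
  induction n with
  | zero => exact continuousOn_const
  | succ n ih =>
    exact continuousOn_primitive_interval' (hG.mul_continuousOn ih) left_mem_uIcc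

/-- The induction bounds `∫ g γⁿ / n!` with `γ` the primitive of `g`, which is `γⁿ⁺¹ / (n + 1)!`. -/
lemma norm_dysonTerm_le {g : ℝ → ℝ}
    (hg : IntervalIntegrable g volume 0 T) (hGg : ∀ s, ‖G s‖ ≤ g s) (n : ℕ) {t : ℝ}
    (ht : t ∈ Icc 0 T) :
    ‖dysonTerm G n t‖ ≤ (∫ s in (0 : ℝ)..t, g s) ^ n / n.factorial := by
  induction n generalizing t with
  | zero => simpa [dysonTerm] using norm_one_matrix_le N
  | succ n ih =>
    have hu : t ∈ uIcc 0 T := by rwa [uIcc_of_le (ht.1.trans ht.2)]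
    have hgt := intervalIntegrable_sub_interval hg left_mem_uIcc hu
    have hgc : ContinuousOn (fun s => (∫ r in (0 : ℝ)..s, g r)) (uIcc 0 t) :=
      continuousOn_primitive_interval' hgt left_mem_uIcc
    calc ‖dysonTerm G (n + 1) t‖
        ≤ ∫ s in (0 : ℝ)..t, g s * (∫ r in (0 : ℝ)..s, g r) ^ n / n.factorial := by
          refine norm_integral_le_of_norm_le ht.1 (ae_of_all _ fun s hs => ?_) ?_
          · rw [mul_div_assoc]
            refine (norm_mul_le _ _).trans (mul_le_mul (hGg s) ?_ (norm_nonneg _)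
              ((norm_nonneg _).trans (hGg s)))
            exact ih ⟨hs.1.le, hs.2.trans ht.2⟩
          · exact (hgt.mul_continuousOn (hgc.pow n)).div_const _
      _ = _ := by
          rw [intervalIntegral.integral_div, integral_mul_primitive_pow hgt, Nat.factorial_succ]
          push_cast
          rw [div_div]

/-- The bound on the terms of the Dyson series that is uniform in the time. -/
lemma norm_dysonTerm_le_uniform {g : ℝ → ℝ}
    (hg : IntervalIntegrable g volume 0 T) (hGg : ∀ s, ‖G s‖ ≤ g s) (n : ℕ) {t : ℝ}
    (ht : t ∈ Icc 0 T) :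
    ‖dysonTerm G n t‖ ≤ (∫ s in (0 : ℝ)..T, g s) ^ n / n.factorial := by
  have h0 : ∀ s, 0 ≤ g s := fun s => (norm_nonneg _).trans (hGg s)
  refine (norm_dysonTerm_le hg hGg n ht).trans ?_
  have h1 : 0 ≤ ∫ s in (0 : ℝ)..t, g s := integral_nonneg ht.1 fun s _ => h0 s
  have h2 : ∫ s in (0 : ℝ)..t, g s ≤ ∫ s in (0 : ℝ)..T, g s :=
    integral_mono_interval le_rfl ht.1 ht.2 (ae_of_all _ h0) hg
  gcongr

lemma summable_norm_dysonTerm (hG : IntervalIntegrable G volume 0 T) {t : ℝ}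
    (ht : t ∈ Icc 0 T) : Summable fun n => ‖dysonTerm G n t‖ :=
  Summable.of_nonneg_of_le (fun _ => norm_nonneg _)
    (fun n => norm_dysonTerm_le hG.norm (fun _ => le_rfl) n ht) (Real.summable_pow_div_factorial _)

lemma continuousOn_timeOrderedExp (hG : IntervalIntegrable G volume 0 T) (hT : 0 ≤ T) :
    ContinuousOn (timeOrderedExp G) (Icc 0 T) := by
  refine continuousOn_tsum (fun n => ?_) (Real.summable_pow_div_factorial (∫ s in (0 : ℝ)..T, ‖G s‖))
    fun n t ht => norm_dysonTerm_le_uniform hG.norm (fun _ => le_rfl) n ht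
  simpa [uIcc_of_le hT] using continuousOn_dysonTerm hG n

/-- The time-ordered exponential solves `u' = G u`, `u(0) = 1` in integrated form. -/
lemma timeOrderedExp_eq_one_add_integral (hG : IntervalIntegrable G volume 0 T) {t : ℝ}
    (ht : t ∈ Icc 0 T) :
    timeOrderedExp G t = 1 + ∫ s in (0 : ℝ)..t, G s * timeOrderedExp G s := by
  have hu : t ∈ uIcc 0 T := by rwa [uIcc_of_le (ht.1.trans ht.2)]
  have hGt := intervalIntegrable_sub_interval hG left_mem_uIcc hu
  have hsum : ∀ s ∈ Icc 0 T, Summable fun n => dysonTerm G n s := fun s hs =>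
    (summable_norm_dysonTerm hG hs).of_norm
  set c : ℝ := ∫ s in (0 : ℝ)..T, ‖G s‖
  have key : HasSum (fun n => ∫ s in (0 : ℝ)..t, G s * dysonTerm G n s)
      (∫ s in (0 : ℝ)..t, G s * timeOrderedExp G s) := by
    refine hasSum_integral_of_dominated_convergence
      (fun n s => ‖G s‖ * (c ^ n / n.factorial)) (fun n => ?_) (fun n => ae_of_all _ fun s hs => ?_)
      (ae_of_all _ fun s hs => ?_) ?_ (ae_of_all _ fun s hs => ?_)
    · rw [uIoc_of_le ht.1]
      exact (hGt.mul_continuousOn ((continuousOn_dysonTerm hG n).mono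
        (uIcc_subset_uIcc left_mem_uIcc hu))).aestronglyMeasurable
    · rw [uIoc_of_le ht.1] at hs
      refine (norm_mul_le _ _).trans (mul_le_mul_of_nonneg_left ?_ (norm_nonneg _))
      exact norm_dysonTerm_le_uniform hG.norm (fun _ => le_rfl) n ⟨hs.1.le, hs.2.trans ht.2⟩
    · exact (Real.summable_pow_div_factorial c).mul_left _
    · simp_rw [tsum_mul_left]
      exact hGt.norm.mul_const _
    · rw [uIoc_of_le ht.1] at hs
      exact (hsum s ⟨hs.1.le, hs.2.trans ht.2⟩).hasSum.mul_left _
  rw [timeOrderedExp, (hsum t ht).tsum_eq_zero_add]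
  exact congrArg _ key.tsum_eq

/-- If the Hermitian part of the generator is negative semidefinite, the evolution is a
contraction: `‖U v‖²` is absolutely continuous with derivative `2 Re ⟪U v, G U v⟫ ≤ 0` almost
everywhere. -/
lemma norm_timeOrderedExp_le_one (hG : IntervalIntegrable G volume 0 T) (hT : 0 ≤ T)
    (hdiss : ∀ s ∈ Icc 0 T, ∀ v : EuclideanSpace ℂ (Fin N),
      (inner ℂ v (Matrix.toEuclideanCLM (𝕜 := ℂ) (G s) v)).re ≤ 0) :
    ‖timeOrderedExp G T‖ ≤ 1 := by
  rw [Matrix.l2_opNorm_def]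
  refine ContinuousLinearMap.opNorm_le_bound _ zero_le_one fun v => ?_
  rw [one_mul]
  set U := timeOrderedExp G
  -- evaluation at `v`, as a real-linear continuous map on matrices
  let ev : Matrix (Fin N) (Fin N) ℂ →L[ℝ] EuclideanSpace ℂ (Fin N) :=
    LinearMap.toContinuousLinearMap
      { toFun := fun M => Matrix.toEuclideanCLM (𝕜 := ℂ) M v
        map_add' := fun M M' => by simp
        map_smul' := fun r M => by
          rw [← Complex.coe_smul r M, map_smul]; simp }
  have hev : ∀ M, ev M = Matrix.toEuclideanCLM (𝕜 := ℂ) M v := fun M => rfl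
  have hUc : ContinuousOn U (uIcc 0 T) := by
    rw [uIcc_of_le hT]; exact continuousOn_timeOrderedExp hG hT
  have hGU : IntervalIntegrable (fun s => G s * U s) volume 0 T := hG.mul_continuousOn hUc
  set g : ℝ → EuclideanSpace ℂ (Fin N) := fun s => ev (G s * U s)
  have hg : IntervalIntegrable g volume 0 T :=
    ⟨ev.integrable_comp hGU.1, ev.integrable_comp hGU.2⟩
  -- `x t = U t v`, written as a primitive so that it is differentiable almost everywhere
  set x : ℝ → EuclideanSpace ℂ (Fin N) := fun t => v + ∫ s in (0 : ℝ)..t, g s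
  have hx : ∀ t ∈ Icc 0 T, ev (U t) = x t := by
    intro t ht
    have hu : t ∈ uIcc 0 T := by rwa [uIcc_of_le hT]
    rw [show U t = _ from timeOrderedExp_eq_one_add_integral hG ht, map_add,
      ← ev.intervalIntegral_comp_comm (intervalIntegrable_sub_interval hGU left_mem_uIcc hu)]
    simp [hev, x, g, U]
  have hxac : AbsolutelyContinuousOnInterval (fun t => ‖x t‖) 0 T :=
    hg.absolutelyContinuousOnInterval_primitive.of_dist_le fun s _ r _ => by
      refine (dist_norm_norm_le _ _).trans ?_
      simp [x, dist_eq_norm]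
  have hφ := (hxac.fun_mul hxac).integral_deriv_eq_sub
  have hle : ∫ s in (0 : ℝ)..T, deriv (fun t => ‖x t‖ * ‖x t‖) s ≤ 0 := by
    have hnn : 0 ≤ ∫ s in (0 : ℝ)..T, -deriv (fun t => ‖x t‖ * ‖x t‖) s := by
      refine integral_nonneg_of_ae_restrict hT ?_
      rw [EventuallyLE, ae_restrict_iff' measurableSet_Icc]
      filter_upwards [hg.ae_hasDerivAt_integral] with s hs hsI
      have hs' : HasDerivAt x (g s) s :=
        (hs (by rwa [uIcc_of_le hT]) 0 left_mem_uIcc).const_add v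
      have hd := hs'.norm_sq
      simp only [sq] at hd
      rw [hd.deriv, Pi.zero_apply]
      have h1 : g s = Matrix.toEuclideanCLM (𝕜 := ℂ) (G s) (x s) := by
        rw [← hx s hsI]; simp [g, hev]
      have h2 := hdiss s hsI (x s)
      rw [← h1] at h2
      have h3 : inner ℝ (x s) (g s) = (inner ℂ (x s) (g s)).re := by
        simp [PiLp.inner_apply, Complex.inner]
      rw [h3]; linarith
    rw [intervalIntegral.integral_neg] at hnn
    linarith
  rw [hφ] at hle
  have hx0 : x 0 = v := by simp [x]
  have hfin : ‖x T‖ ≤ ‖v‖ := by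
    rw [hx0] at hle
    exact abs_le_of_sq_le_sq' (by nlinarith) (norm_nonneg _) |>.2
  calc _ = ‖ev (U T)‖ := rfl
    _ ≤ ‖v‖ := by rw [hx T (right_mem_Icc.2 hT)]; exact hfin

/-- Along an affine family of generators each term of the Dyson series is a polynomial in the
parameter. -/
lemma exists_dysonTerm_affine_eq_sum {B C : ℝ → Matrix (Fin N) (Fin N) ℂ}
    (hB : IntervalIntegrable B volume 0 T) (hC : IntervalIntegrable C volume 0 T) (n : ℕ) :
    ∃ (ι : Type) (_ : Fintype ι) (e : ι → ℕ) (P : ι → ℝ → Matrix (Fin N) (Fin N) ℂ),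
      (∀ i, ContinuousOn (P i) (uIcc 0 T)) ∧
      ∀ (z : ℂ), ∀ t ∈ uIcc 0 T,
        dysonTerm (fun s => z • B s + C s) n t = ∑ i, z ^ e i • P i t := by
  induction n with
  | zero => exact ⟨Unit, inferInstance, fun _ => 0, fun _ _ => 1, fun _ => continuousOn_const,
      fun z t _ => by simp [dysonTerm]⟩
  | succ n ih =>
    obtain ⟨ι, _, e, P, hP, h⟩ := ih
    refine ⟨ι ⊕ ι, inferInstance, Sum.elim (fun i => e i + 1) e,
      Sum.elim (fun i t => ∫ s in (0 : ℝ)..t, B s * P i s) fun i t => ∫ s in (0 : ℝ)..t, C s * P i s,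
      ?_, fun z t ht => ?_⟩
    · rintro (i | i)
      · exact continuousOn_primitive_interval' (hB.mul_continuousOn (hP i)) left_mem_uIcc
      · exact continuousOn_primitive_interval' (hC.mul_continuousOn (hP i)) left_mem_uIcc
    · have hBi : ∀ i, IntervalIntegrable (fun s => B s * P i s) volume 0 t := fun i =>
        intervalIntegrable_sub_interval (hB.mul_continuousOn (hP i)) left_mem_uIcc ht
      have hCi : ∀ i, IntervalIntegrable (fun s => C s * P i s) volume 0 t := fun i =>
        intervalIntegrable_sub_interval (hC.mul_continuousOn (hP i)) left_mem_uIcc ht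
      have h1 : dysonTerm (fun s => z • B s + C s) (n + 1) t
          = ∫ s in (0 : ℝ)..t, ∑ i, (z ^ (e i + 1) • (B s * P i s) + z ^ e i • (C s * P i s)) := by
        refine intervalIntegral.integral_congr fun s hs => ?_
        simp only []
        rw [h z s (uIcc_subset_uIcc left_mem_uIcc ht hs), Finset.mul_sum]
        refine Finset.sum_congr rfl fun i _ => ?_
        rw [add_mul, mul_smul_comm, mul_smul_comm, smul_mul_assoc, smul_smul, ← pow_succ]
      rw [h1, intervalIntegral.integral_finsetSum (fun i _ => by
        exact ((hBi i).smul (z ^ (e i + 1))).add ((hCi i).smul (z ^ e i))),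
        Fintype.sum_sum_type, ← Finset.sum_add_distrib]
      refine Finset.sum_congr rfl fun i _ => ?_
      refine (intervalIntegral.integral_add ((hBi i).smul (z ^ (e i + 1)))
        ((hCi i).smul (z ^ e i))).trans ?_
      simp

/-- The time-ordered exponential is an entire function of the parameter of an affine family of
generators. -/
lemma differentiable_timeOrderedExp_affine {B C : ℝ → Matrix (Fin N) (Fin N) ℂ}
    (hB : IntervalIntegrable B volume 0 T) (hC : IntervalIntegrable C volume 0 T) (hT : 0 ≤ T) :
    Differentiable ℂ fun z : ℂ => timeOrderedExp (fun s => z • B s + C s) T := by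
  intro z₀
  set R : ℝ := ‖z₀‖ + 1
  have hz₀ : Metric.ball (0 : ℂ) R ∈ 𝓝 z₀ :=
    Metric.isOpen_ball.mem_nhds (by simp [R])
  refine DifferentiableOn.differentiableAt ?_ hz₀
  refine Complex.differentiableOn_tsum_of_summable_norm
    (Real.summable_pow_div_factorial (∫ s in (0 : ℝ)..T, (R * ‖B s‖ + ‖C s‖))) (fun n => ?_)
    Metric.isOpen_ball fun n z hz => ?_
  · obtain ⟨ι, _, e, P, -, h⟩ := exists_dysonTerm_affine_eq_sum hB hC n
    simp_rw [h _ T right_mem_uIcc]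
    fun_prop
  · refine norm_dysonTerm_le_uniform ((hB.norm.const_mul R).add hC.norm)
      (fun s => (norm_add_le _ _).trans ?_) n (right_mem_Icc.2 hT)
    rw [norm_smul z (B s)]
    have : ‖z‖ ≤ R := by simpa using (Metric.mem_ball.1 hz).le
    gcongr

end Dyson

/-! ### A Cauchy formula for the lower half-plane -/

section HalfPlane

variable {E : Type*} [NormedAddCommGroup E] [NormedSpace ℂ E]

/-- Cauchy's theorem for the lower half-plane. The contour is the boundary of the square
`[-R, R] × [-R, 0]`; the three sides inside the half-plane contribute `O(1 / R)`. -/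
lemma integral_real_eq_zero_of_lowerHalfPlane {G : ℂ → E} {C : ℝ}
    (hc : ContinuousOn G {z : ℂ | z.im ≤ 0}) (hd : DifferentiableOn ℂ G {z : ℂ | z.im < 0})
    (hb : ∀ z : ℂ, z.im ≤ 0 → 2 ≤ ‖z‖ → ‖z‖ ^ 2 * ‖G z‖ ≤ C)
    (hint : Integrable fun k : ℝ => G k) : ∫ k : ℝ, G k = 0 := by
  have hlim : Tendsto (fun R : ℝ => ∫ k in (-R)..R, G (k : ℂ)) atTop (𝓝 (∫ k : ℝ, G k)) :=
    intervalIntegral_tendsto_integral hint tendsto_neg_atTop_atBot tendsto_id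
  have hsmall : ∀ᶠ R : ℝ in atTop, ‖∫ k in (-R)..R, G (k : ℂ)‖ ≤ 4 * C / R := by
    filter_upwards [eventually_ge_atTop (2 : ℝ)] with R hR
    have hR0 : 0 < R := by linarith
    have hside : ∀ z : ℂ, z.im ≤ 0 → R ≤ ‖z‖ → ‖G z‖ ≤ C / R ^ 2 := by
      intro z hz hRz
      rw [le_div_iff₀ (by positivity), mul_comm]
      refine le_trans ?_ (hb z hz (hR.trans hRz))
      gcongr
    have hcauchy := Complex.integral_boundary_rect_eq_zero_of_continuousOn_of_differentiableOn G
      (⟨-R, -R⟩ : ℂ) (⟨R, 0⟩ : ℂ)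
      (hc.mono fun z hz => by
        have := hz.2
        rw [mem_preimage, uIcc_of_le (by linarith)] at this
        exact this.2)
      (hd.mono fun z hz => by
        have := hz.2
        simp only [mem_preimage] at this
        rw [min_eq_left (by linarith), max_eq_right (by linarith)] at this
        exact this.2)
    simp only [Complex.ofReal_zero, zero_mul, add_zero] at hcauchy
    have h1 : ‖∫ x in (-R)..R, G (x + ((-R : ℝ) : ℂ) * Complex.I)‖ ≤ C / R ^ 2 * |R - -R| := by
      refine intervalIntegral.norm_integral_le_of_norm_le_const fun x _ => hside _ ?_ ?_
      · simpa using hR0.le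
      · refine le_trans ?_ (Complex.abs_im_le_norm _)
        simp [abs_of_pos hR0]
    have h2 : ∀ a : ℝ, |a| = R →
        ‖∫ y in (-R)..0, G ((a : ℂ) + y * Complex.I)‖ ≤ C / R ^ 2 * |0 - -R| := by
      intro a ha
      refine intervalIntegral.norm_integral_le_of_norm_le_const fun y hy => hside _ ?_ ?_
      · rw [uIoc_of_le (by linarith)] at hy
        simpa using hy.2
      · refine le_trans ?_ (Complex.abs_re_le_norm _)
        simp [ha]
    have h3 := h2 R (abs_of_pos hR0)
    have h4 := h2 (-R) (by rw [abs_neg, abs_of_pos hR0])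
    have h5 : ∫ k in (-R)..R, G (k : ℂ)
        = (∫ x in (-R)..R, G (x + ((-R : ℝ) : ℂ) * Complex.I))
          + Complex.I • (∫ y in (-R)..0, G ((R : ℂ) + y * Complex.I))
          - Complex.I • (∫ y in (-R)..0, G (((-R : ℝ) : ℂ) + y * Complex.I)) := by
      rw [← sub_eq_zero, ← neg_eq_zero, ← hcauchy]
      abel
    rw [h5]
    refine (norm_sub_le _ _).trans ((add_le_add (norm_add_le _ _) le_rfl).trans ?_)
    rw [norm_smul, norm_smul, Complex.norm_I, one_mul, one_mul]
    refine (add_le_add (add_le_add h1 h3) h4).trans (le_of_eq ?_)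
    rw [abs_of_pos (by linarith), abs_of_pos (by linarith)]
    field_simp
    ring
  have hzero : Tendsto (fun R : ℝ => ∫ k in (-R)..R, G (k : ℂ)) atTop (𝓝 0) :=
    squeeze_zero_norm' hsmall (tendsto_const_nhds.div_atTop tendsto_id)
  exact tendsto_nhds_unique hlim hzero

/-- Cauchy's formula at `-i`, the only zero of `1 - i z`, for a function that is continuous on the
closed lower half-plane, holomorphic inside and `O(1 / |z|)`. -/
lemma integrable_and_integral_inv_one_sub_I_mul_smul [CompleteSpace E] {h : ℂ → E} {C : ℝ}
    (hc : ContinuousOn h {z : ℂ | z.im ≤ 0}) (hd : DifferentiableOn ℂ h {z : ℂ | z.im < 0})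
    (hb : ∀ z : ℂ, z.im ≤ 0 → (1 + ‖z‖) * ‖h z‖ ≤ C) :
    Integrable (fun k : ℝ => (1 - Complex.I * (k : ℂ))⁻¹ • h k) ∧
      ∫ k : ℝ, (1 - Complex.I * (k : ℂ))⁻¹ • h k = (2 * (Real.pi : ℂ)) • h (-Complex.I) := by
  have hne : ∀ k : ℝ, 1 - Complex.I * (k : ℂ) ≠ 0 := fun k hk => by
    simpa using congrArg Complex.re hk
  have hnorm : ∀ k : ℝ, ‖1 - Complex.I * (k : ℂ)‖ ^ 2 = 1 + k ^ 2 := fun k => by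
    rw [Complex.sq_norm, Complex.normSq_apply]; simp; ring
  have hcont : Continuous fun k : ℝ => h k :=
    hc.comp_continuous Complex.continuous_ofReal fun k => by simp
  have hint : Integrable (fun k : ℝ => (1 - Complex.I * (k : ℂ))⁻¹ • h k) := by
    refine (integrable_inv_one_add_sq.const_mul C).mono' ?_ (ae_of_all _ fun k => ?_)
    · exact ((Continuous.inv₀ (by fun_prop) hne).smul hcont).aestronglyMeasurable
    · have h0 : 0 < ‖1 - Complex.I * (k : ℂ)‖ := norm_pos_iff.2 (hne k)
      have h1 : ‖1 - Complex.I * (k : ℂ)‖ ≤ 1 + ‖(k : ℂ)‖ := by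
        refine (norm_sub_le _ _).trans ?_
        simp
      rw [norm_smul, norm_inv, ← hnorm k, ← div_eq_mul_inv, le_div_iff₀ (by positivity)]
      calc _ = ‖1 - Complex.I * (k : ℂ)‖ * ‖h k‖ := by field_simp
        _ ≤ (1 + ‖(k : ℂ)‖) * ‖h k‖ := by gcongr
        _ ≤ C := hb k (by simp)
  refine ⟨hint, ?_⟩
  -- `-2i / (z - i)` is `1` at `-i`, holomorphic on the half-plane and `O(1 / z)`: subtracting the
  -- corresponding multiple of `h (-i)` removes the pole and keeps the decay
  set p : ℂ → ℂ := fun z => -2 * Complex.I / (z - Complex.I) with hp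
  set g : ℂ → E := fun z => h z - p z • h (-Complex.I) with hg
  have hpne : ∀ z : ℂ, z.im ≤ 0 → z - Complex.I ≠ 0 := fun z hz h0 => by
    have : z.im = 1 := by simpa [sub_eq_zero] using congrArg Complex.im h0
    linarith
  have hg0 : g (-Complex.I) = 0 := by
    have : p (-Complex.I) = 1 := by
      simp only [hp]
      rw [div_eq_one_iff_eq (hpne _ (by simp))]; ring
    simp [hg, this]
  have hpd : DifferentiableOn ℂ p {z : ℂ | z.im ≤ 0} :=
    DifferentiableOn.div (by fun_prop) (by fun_prop) hpne
  have hgc : ContinuousOn g {z : ℂ | z.im ≤ 0} := hc.sub (hpd.continuousOn.smul continuousOn_const)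
  have hsub : {z : ℂ | z.im < 0} ⊆ {z : ℂ | z.im ≤ 0} := fun z (hz : z.im < 0) =>
    show z.im ≤ 0 from hz.le
  have hgd : DifferentiableOn ℂ g {z : ℂ | z.im < 0} := hd.sub ((hpd.mono hsub).smul_const _)
  have hopen : IsOpen {z : ℂ | z.im < 0} := isOpen_lt Complex.continuous_im continuous_const
  have hlt : {z : ℂ | z.im < 0} ∈ 𝓝 (-Complex.I) := hopen.mem_nhds (by simp)
  have hGd : DifferentiableOn ℂ (dslope g (-Complex.I)) {z : ℂ | z.im < 0} :=
    (Complex.differentiableOn_dslope hlt).2 hgd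
  have hGc : ContinuousOn (dslope g (-Complex.I)) {z : ℂ | z.im ≤ 0} :=
    (continuousOn_dslope (mem_of_superset hlt hsub)).2
      ⟨hgc, hgd.differentiableAt hlt⟩
  have hG : ∀ z : ℂ, z ≠ -Complex.I →
      dslope g (-Complex.I) z = (z + Complex.I)⁻¹ • g z := fun z hz => by
    rw [dslope_of_ne _ hz, slope_def_module, hg0, sub_zero, sub_neg_eq_add]
  have hGb : ∀ z : ℂ, z.im ≤ 0 → 2 ≤ ‖z‖ →
      ‖z‖ ^ 2 * ‖dslope g (-Complex.I) z‖ ≤ 2 * (C + 4 * ‖h (-Complex.I)‖) := by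
    intro z hz h2
    have hz0 : 0 < ‖z‖ := by linarith
    have hadd : ‖z‖ / 2 ≤ ‖z + Complex.I‖ := by
      have := norm_sub_le (z + Complex.I) Complex.I
      rw [add_sub_cancel_right, Complex.norm_I] at this
      linarith
    have hsub : ‖z‖ / 2 ≤ ‖z - Complex.I‖ := by
      have := norm_add_le (z - Complex.I) Complex.I
      rw [sub_add_cancel, Complex.norm_I] at this
      linarith
    have hhz : ‖z‖ * ‖h z‖ ≤ C :=
      le_trans (by gcongr; linarith) (hb z hz)
    have hpz : ‖z‖ * ‖p z‖ ≤ 4 := by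
      simp only [hp, norm_div, norm_mul, norm_neg, Complex.norm_I, Complex.norm_ofNat]
      rw [← mul_div_assoc, div_le_iff₀ (by linarith)]
      linarith
    have hgz : ‖z‖ * ‖g z‖ ≤ C + 4 * ‖h (-Complex.I)‖ := by
      calc ‖z‖ * ‖g z‖ ≤ ‖z‖ * (‖h z‖ + ‖p z‖ * ‖h (-Complex.I)‖) := by
            gcongr
            exact (norm_sub_le _ _).trans_eq (by rw [norm_smul])
        _ = ‖z‖ * ‖h z‖ + ‖z‖ * ‖p z‖ * ‖h (-Complex.I)‖ := by ring
        _ ≤ _ := by gcongr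
    rw [hG z (by rintro rfl; norm_num at h2), norm_smul, norm_inv]
    have hinv : ‖z + Complex.I‖⁻¹ ≤ (‖z‖ / 2)⁻¹ := by gcongr
    calc ‖z‖ ^ 2 * (‖z + Complex.I‖⁻¹ * ‖g z‖) ≤ ‖z‖ ^ 2 * ((‖z‖ / 2)⁻¹ * ‖g z‖) := by gcongr
      _ = 2 * (‖z‖ * ‖g z‖) := by field_simp
      _ ≤ _ := by gcongr
  have hsplit : ∀ k : ℝ, (1 - Complex.I * (k : ℂ))⁻¹ • h k
      = Complex.I • dslope g (-Complex.I) k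
        + ((2 * (1 + k ^ 2)⁻¹ : ℝ) : ℂ) • h (-Complex.I) := by
    intro k
    have hk : (k : ℂ) ≠ -Complex.I := fun h0 => by simpa using congrArg Complex.im h0
    have e1 : (k : ℂ) + Complex.I ≠ 0 := fun h0 => hk (eq_neg_of_add_eq_zero_left h0)
    have e2 := hpne k (by simp)
    have c1 : (1 - Complex.I * (k : ℂ))⁻¹ = Complex.I * ((k : ℂ) + Complex.I)⁻¹ := by
      rw [inv_eq_iff_eq_inv, mul_inv, inv_inv, Complex.inv_I]
      linear_combination Complex.I_sq
    have c2 : ((2 * (1 + k ^ 2)⁻¹ : ℝ) : ℂ) = Complex.I * ((k : ℂ) + Complex.I)⁻¹ * p k := by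
      have : (1 + (k : ℂ) ^ 2) = (k + Complex.I) * (k - Complex.I) := by
        linear_combination Complex.I_sq
      push_cast
      rw [this]
      simp only [hp]
      field_simp
      linear_combination Complex.I_sq
    rw [hG k hk, c1, c2]
    simp only [hg, smul_sub, smul_smul, mul_assoc, sub_add_cancel]
  have hint2 : Integrable fun k : ℝ => ((2 * (1 + k ^ 2)⁻¹ : ℝ) : ℂ) • h (-Complex.I) :=
    ((integrable_inv_one_add_sq.const_mul 2).ofReal).smul_const _
  have hintG' : Integrable fun k : ℝ => Complex.I • dslope g (-Complex.I) k := by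
    refine (hint.sub hint2).congr (ae_of_all _ fun k => ?_)
    simp [hsplit k]
  have hintG : Integrable fun k : ℝ => dslope g (-Complex.I) k := by
    refine (hintG'.smul (-Complex.I)).congr (ae_of_all _ fun k => ?_)
    simp [smul_smul]
  simp_rw [hsplit]
  rw [integral_add hintG' hint2, integral_smul,
    integral_real_eq_zero_of_lowerHalfPlane hGc hGd hGb hintG, smul_zero, zero_add,
    integral_smul_const, integral_complex_ofReal, integral_const_mul, integral_univ_inv_one_add_sq]
  push_cast
  rfl

end HalfPlane

/-! ### Fourier–Laplace integrals of functions supported on the negative half-line -/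

section FourierLaplace

variable {g : ℝ → ℂ}

lemma norm_cexp_I_mul_mul (z : ℂ) (x : ℝ) :
    ‖Complex.exp (Complex.I * z * (x : ℂ))‖ = Real.exp (-z.im * x) := by
  rw [Complex.norm_exp]; simp

lemma norm_mul_cexp_I_mul_le (hg0 : ∀ x, 0 < x → g x = 0) {z : ℂ} (hz : z.im ≤ 0) (x : ℝ) :
    ‖g x * Complex.exp (Complex.I * z * (x : ℂ))‖ ≤ ‖g x‖ := by
  rcases lt_or_ge 0 x with hx | hx
  · simp [hg0 x hx]
  · rw [norm_mul, norm_cexp_I_mul_mul]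
    refine mul_le_of_le_one_right (norm_nonneg _) (Real.exp_le_one_iff.2 ?_)
    nlinarith

lemma aestronglyMeasurable_mul_cexp_I_mul (hg : Integrable g) (z : ℂ) :
    AEStronglyMeasurable (fun x : ℝ => g x * Complex.exp (Complex.I * z * (x : ℂ))) :=
  hg.aestronglyMeasurable.mul (by fun_prop : Continuous _).aestronglyMeasurable

lemma integrable_mul_cexp_I_mul (hg : Integrable g) (hg0 : ∀ x, 0 < x → g x = 0) {z : ℂ}
    (hz : z.im ≤ 0) : Integrable fun x : ℝ => g x * Complex.exp (Complex.I * z * (x : ℂ)) :=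
  hg.mono (aestronglyMeasurable_mul_cexp_I_mul hg z)
    (ae_of_all _ fun x => norm_mul_cexp_I_mul_le hg0 hz x)

lemma norm_integral_mul_cexp_I_mul_le (hg : Integrable g) (hg0 : ∀ x, 0 < x → g x = 0) {z : ℂ}
    (hz : z.im ≤ 0) :
    ‖∫ x : ℝ, g x * Complex.exp (Complex.I * z * (x : ℂ))‖ ≤ ∫ x : ℝ, ‖g x‖ :=
  norm_integral_le_of_norm_le hg.norm (ae_of_all _ fun x => norm_mul_cexp_I_mul_le hg0 hz x)

lemma continuousOn_integral_mul_cexp_I_mul (hg : Integrable g) (hg0 : ∀ x, 0 < x → g x = 0) :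
    ContinuousOn (fun z : ℂ => ∫ x : ℝ, g x * Complex.exp (Complex.I * z * (x : ℂ)))
      {z : ℂ | z.im ≤ 0} :=
  continuousOn_of_dominated (fun z _ => aestronglyMeasurable_mul_cexp_I_mul hg z)
    (fun _ hz => ae_of_all _ fun x => norm_mul_cexp_I_mul_le hg0 hz x) hg.norm
    (ae_of_all _ fun _ => by fun_prop)

lemma differentiableOn_integral_mul_cexp_I_mul (hg : Integrable g)
    (hg0 : ∀ x, 0 < x → g x = 0) :
    DifferentiableOn ℂ (fun z : ℂ => ∫ x : ℝ, g x * Complex.exp (Complex.I * z * (x : ℂ)))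
      {z : ℂ | z.im < 0} := by
  intro z₀ hz₀
  have hz₀' : z₀.im < 0 := hz₀
  set δ : ℝ := -z₀.im / 2 with hδ
  have hδ0 : 0 < δ := by linarith
  have hs : {z : ℂ | z.im < -δ} ∈ 𝓝 z₀ :=
    (isOpen_lt Complex.continuous_im continuous_const).mem_nhds (by simp [hδ]; linarith)
  refine (hasDerivAt_integral_of_dominated_loc_of_deriv_le (bound := fun x => ‖g x‖ * δ⁻¹)
    (F' := fun z x => g x * (Complex.exp (Complex.I * z * (x : ℂ)) * (Complex.I * x))) hs
    (Eventually.of_forall fun z => aestronglyMeasurable_mul_cexp_I_mul hg z)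
    (integrable_mul_cexp_I_mul hg hg0 hz₀'.le) ?_ (ae_of_all _ fun x z hz => ?_)
    (hg.norm.mul_const _) (ae_of_all _ fun x z _ => ?_)).2.differentiableAt.differentiableWithinAt
  · exact hg.aestronglyMeasurable.mul (by fun_prop : Continuous _).aestronglyMeasurable
  · rcases lt_or_ge 0 x with hx | hx
    · simp [hg0 x hx]
    · have hz' : z.im < -δ := hz
      rw [norm_mul, norm_mul, norm_cexp_I_mul_mul, norm_mul, Complex.norm_I, one_mul,
        Complex.norm_real, Real.norm_of_nonpos hx]
      gcongr
      -- `|x| e^{δ x} ≤ 1 / δ` for `x ≤ 0`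
      have h1 : Real.exp (-z.im * x) ≤ Real.exp (δ * x) := Real.exp_le_exp.2 (by nlinarith)
      have h2 : δ * -x ≤ Real.exp (-(δ * x)) := by
        have := Real.add_one_le_exp (-(δ * x))
        linarith
      rw [← one_div, le_div_iff₀ hδ0]
      calc Real.exp (-z.im * x) * -x * δ ≤ Real.exp (δ * x) * -x * δ := by
            have : 0 ≤ -x := by linarith
            gcongr
        _ = Real.exp (δ * x) * (δ * -x) := by ring
        _ ≤ Real.exp (δ * x) * Real.exp (-(δ * x)) := by gcongr
        _ = 1 := by rw [← Real.exp_add]; simp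
  · have h : HasDerivAt (fun z : ℂ => Complex.I * z * (x : ℂ)) (Complex.I * x) z := by
      simpa using ((hasDerivAt_id z).const_mul Complex.I).mul_const (x : ℂ)
    exact h.cexp.const_mul _

/-- Integration by parts; it turns integrability of `g'` into decay of the transform of `g`. -/
lemma integral_deriv_mul_cexp_I_mul (hg : Integrable g) (hg0 : ∀ x, 0 < x → g x = 0)
    {g' : ℝ → ℂ} (hg' : Integrable g') (hg'0 : ∀ x, 0 < x → g' x = 0)
    (hd : ∀ x, HasDerivAt g (g' x) x) {z : ℂ} (hz : z.im ≤ 0) :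
    ∫ x : ℝ, g' x * Complex.exp (Complex.I * z * (x : ℂ))
      = -(Complex.I * z) * ∫ x : ℝ, g x * Complex.exp (Complex.I * z * (x : ℂ)) := by
  have i1 := integrable_mul_cexp_I_mul hg hg0 hz
  have i2 := integrable_mul_cexp_I_mul hg' hg'0 hz
  have h := integral_eq_zero_of_hasDerivAt_of_integrable
    (f := fun x : ℝ => g x * Complex.exp (Complex.I * z * (x : ℂ)))
    (f' := fun x : ℝ => g' x * Complex.exp (Complex.I * z * (x : ℂ))
      + Complex.I * z * (g x * Complex.exp (Complex.I * z * (x : ℂ))))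
    (fun x => by
      have he : HasDerivAt (fun x : ℝ => Complex.I * z * (x : ℂ)) (Complex.I * z) x := by
        simpa using (Complex.ofRealCLM.hasDerivAt (x := x)).const_mul (Complex.I * z)
      refine ((hd x).fun_mul he.cexp).congr_deriv ?_
      ring) (i2.add (i1.const_mul _)) i1
  rw [integral_add i2 (i1.const_mul _), integral_const_mul] at h
  linear_combination h

end FourierLaplace

/-! ### The kernel function -/

section Kernel

variable {F : ℝ → ℂ}

lemma deriv_eq_of_eq_exp_neg (hF : ∀ x : ℝ, 0 ≤ x → F x = (Real.exp (-x) : ℂ)) {x : ℝ}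
    (hx : 0 < x) : deriv F x = -(Real.exp (-x) : ℂ) := by
  have h1 : F =ᶠ[𝓝 x] fun y => ((Real.exp (-y) : ℝ) : ℂ) := by
    filter_upwards [lt_mem_nhds hx] with y hy using hF y hy.le
  rw [h1.deriv_eq]
  have h2 : HasDerivAt (fun y : ℝ => Real.exp (-y)) (-Real.exp (-x)) x := by
    simpa using (hasDerivAt_neg x).exp
  simpa using h2.ofReal_comp.deriv

lemma generatingFun_eq_zero (hF : ∀ x : ℝ, 0 ≤ x → F x = (Real.exp (-x) : ℂ)) {x : ℝ}
    (hx : 0 < x) : generatingFun F x = 0 := by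
  rw [generatingFun, deriv_eq_of_eq_exp_neg hF hx, hF x hx.le, add_neg_cancel]

lemma hasDerivAt_generatingFun (hF : ContDiff ℝ 2 F) (x : ℝ) :
    HasDerivAt (generatingFun F) (deriv F x + deriv (deriv F) x) x := by
  have h1 : Differentiable ℝ F := hF.differentiable (by norm_num)
  have h2 : Differentiable ℝ (deriv F) :=
    (contDiff_succ_iff_deriv.1
      (show ContDiff ℝ (1 + 1) F by simpa [one_add_one_eq_two] using hF)).2.2.differentiable
      (by norm_num)
  exact (h1 x).hasDerivAt.add (h2 x).hasDerivAt

lemma deriv_generatingFun_eq_zero (hF : ∀ x : ℝ, 0 ≤ x → F x = (Real.exp (-x) : ℂ))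
    (hF2 : ContDiff ℝ 2 F) {x : ℝ} (hx : 0 < x) : deriv F x + deriv (deriv F) x = 0 := by
  rw [← (hasDerivAt_generatingFun hF2 x).deriv]
  have h1 : generatingFun F =ᶠ[𝓝 x] fun _ => 0 := by
    filter_upwards [lt_mem_nhds hx] with y hy using generatingFun_eq_zero hF hy
  rw [h1.deriv_eq, deriv_const]

/-- The value is `F 0 / 2π`, as `Φ(x) e^x` is the derivative of `F(x) e^x`. -/
lemma kernelFun_neg_I (hF : ∀ x : ℝ, 0 ≤ x → F x = (Real.exp (-x) : ℂ))
    (hF2 : ContDiff ℝ 2 F) (hi : Integrable F) (hi' : Integrable (deriv F)) :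
    kernelFun F (-Complex.I) = 1 / (2 * (Real.pi : ℂ)) := by
  have hI : (-Complex.I).im ≤ 0 := by simp
  have hΦ := integrable_mul_cexp_I_mul (hi.add hi') (z := -Complex.I)
    (fun x hx => generatingFun_eq_zero hF hx) hI
  have hexp : ∀ x : ℝ, Complex.exp (Complex.I * -Complex.I * (x : ℂ)) = ((Real.exp x : ℝ) : ℂ) := by
    intro x; simp
  have hd : ∀ x, HasDerivAt (fun x : ℝ => F x * Complex.exp (Complex.I * -Complex.I * (x : ℂ)))
      (generatingFun F x * Complex.exp (Complex.I * -Complex.I * (x : ℂ))) x := by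
    intro x
    simp_rw [hexp]
    convert! (hF2.differentiable (by norm_num) x).hasDerivAt.mul
      (Real.hasDerivAt_exp x).ofReal_comp using 1
    simp only [generatingFun]; ring
  have hFint : IntegrableOn (fun x : ℝ => F x * Complex.exp (Complex.I * -Complex.I * (x : ℂ)))
      (Iic 0) := by
    refine Integrable.mono hi.integrableOn (aestronglyMeasurable_mul_cexp_I_mul hi _).restrict
      ((ae_restrict_iff' measurableSet_Iic).2 (ae_of_all _ fun x hx => ?_))
    rw [hexp, norm_mul, Complex.norm_real, Real.norm_of_nonneg (Real.exp_pos x).le]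
    exact mul_le_of_le_one_right (norm_nonneg _) (Real.exp_le_one_iff.2 hx)
  have hint := integral_Iic_of_hasDerivAt_of_tendsto' (a := 0) (fun x _ => hd x) hΦ.integrableOn
    (tendsto_zero_of_hasDerivAt_of_integrableOn_Iic (a := 0) (fun x _ => hd x) hΦ.integrableOn
      hFint)
  rw [setIntegral_eq_integral_of_forall_compl_eq_zero fun x hx => by
    rw [generatingFun_eq_zero hF (not_le.1 hx), zero_mul]] at hint
  rw [kernelFun, hint, hF 0 le_rfl]
  simp

end Kernel

/-! ### The evolution generated by `-i (z L + H)` -/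

section Evolution

variable {N : ℕ}

lemma cartesianRe_add_I_smul_cartesianIm (A : Matrix (Fin N) (Fin N) ℂ) :
    cartesianRe A + Complex.I • cartesianIm A = A := by
  have h : Complex.I * (1 / (2 * Complex.I)) = 1 / 2 := by field_simp
  rw [cartesianRe, cartesianIm, smul_smul, h, ← smul_add, add_add_sub_cancel, ← two_smul ℂ A,
    smul_smul]
  norm_num

lemma isHermitian_cartesianIm (A : Matrix (Fin N) (Fin N) ℂ) : (cartesianIm A).IsHermitian := by
  rw [Matrix.IsHermitian, cartesianIm, Matrix.conjTranspose_smul, Matrix.conjTranspose_sub,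
    Matrix.conjTranspose_conjTranspose, ← neg_sub A, smul_neg, ← neg_smul]
  congr 1
  simp

/-- The real part is `(Im z) ⟪v, L v⟫`, as both quadratic forms are real. -/
lemma re_inner_toEuclideanCLM_nonpos {L H : Matrix (Fin N) (Fin N) ℂ} (hL : L.PosSemidef)
    (hH : H.IsHermitian) {z : ℂ} (hz : z.im ≤ 0) (v : EuclideanSpace ℂ (Fin N)) :
    (inner ℂ v (Matrix.toEuclideanCLM (𝕜 := ℂ) ((-Complex.I) • (z • L + H)) v)).re ≤ 0 := by
  have hinner : ∀ M : Matrix (Fin N) (Fin N) ℂ, inner ℂ v (Matrix.toEuclideanCLM (𝕜 := ℂ) M v)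
      = star v.ofLp ⬝ᵥ (M.mulVec v.ofLp) := fun M => by
    rw [EuclideanSpace.inner_eq_star_dotProduct, Matrix.ofLp_toEuclideanCLM, dotProduct_comm]
  have h1 : 0 ≤ (star v.ofLp ⬝ᵥ (L.mulVec v.ofLp)).re := hL.re_dotProduct_nonneg v.ofLp
  have h2 : (star v.ofLp ⬝ᵥ (L.mulVec v.ofLp)).im = 0 :=
    hL.isHermitian.im_star_dotProduct_mulVec_self v.ofLp
  have h3 : (star v.ofLp ⬝ᵥ (H.mulVec v.ofLp)).im = 0 := hH.im_star_dotProduct_mulVec_self v.ofLp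
  rw [hinner, Matrix.smul_mulVec, Matrix.add_mulVec, Matrix.smul_mulVec, dotProduct_smul,
    dotProduct_add, dotProduct_smul]
  simp only [smul_eq_mul, neg_mul, Complex.neg_re, Complex.mul_re, Complex.I_re, Complex.add_re,
    Complex.I_im, Complex.add_im, Complex.mul_im, h2, h3]
  nlinarith

lemma intervalIntegrable_conjTranspose {A : ℝ → Matrix (Fin N) (Fin N) ℂ} {t : ℝ}
    (hA : IntervalIntegrable A volume 0 t) :
    IntervalIntegrable (fun s => (A s).conjTranspose) volume 0 t := by
  have h : ∀ S : Set ℝ, IntegrableOn A S → IntegrableOn (fun s => (A s).conjTranspose) S :=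
    fun S hS => Integrable.mono hS (continuous_star.comp_aestronglyMeasurable hS.aestronglyMeasurable)
      (ae_of_all _ fun s => (norm_star (A s)).le)
  exact ⟨h _ hA.1, h _ hA.2⟩

lemma intervalIntegrable_cartesianRe {A : ℝ → Matrix (Fin N) (Fin N) ℂ} {t : ℝ}
    (hA : IntervalIntegrable A volume 0 t) :
    IntervalIntegrable (fun s => cartesianRe (A s)) volume 0 t :=
  (hA.add (intervalIntegrable_conjTranspose hA)).smul (1 / 2 : ℂ)

lemma intervalIntegrable_cartesianIm {A : ℝ → Matrix (Fin N) (Fin N) ℂ} {t : ℝ}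
    (hA : IntervalIntegrable A volume 0 t) :
    IntervalIntegrable (fun s => cartesianIm (A s)) volume 0 t :=
  (hA.sub (intervalIntegrable_conjTranspose hA)).smul (1 / (2 * Complex.I) : ℂ)

end Evolution

/-! ### The linear combination of Hamiltonian simulation formula -/

theorem mainTheorem1 (F : ℝ → ℂ)
    (hF_exp : ∀ x : ℝ, 0 ≤ x → F x = (Real.exp (-x) : ℂ))
    (hF_smooth : ContDiff ℝ 2 F)
    (hF_int : Integrable F volume)
    (hF_int' : Integrable (deriv F) volume)
    (hF_int'' : Integrable (deriv (deriv F)) volume) :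
    -- the integral that defines the kernel converges absolutely on the closed lower half plane
    (∀ z : ℂ, z.im ≤ 0 → Integrable
      (fun x : ℝ => generatingFun F x * Complex.exp (Complex.I * z * (x : ℂ))) volume) ∧
    -- analyticity
    ContinuousOn (kernelFun F) {z : ℂ | z.im ≤ 0} ∧
    AnalyticOnNhd ℂ (kernelFun F) {z : ℂ | z.im < 0} ∧
    -- decay
    (∃ C : ℝ, ∀ z : ℂ, z.im ≤ 0 → ‖z‖ * ‖kernelFun F z‖ ≤ C) ∧
    -- normalization
    (Integrable (lchsWeight F) volume ∧ ∫ k : ℝ, lchsWeight F k = 1) ∧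
    -- the LCHS identity
    (∀ (N : ℕ) (A : ℝ → Matrix (Fin N) (Fin N) ℂ) (t : ℝ), 0 ≤ t →
      IntervalIntegrable A volume 0 t →
      (∀ s ∈ Set.Icc (0 : ℝ) t, (cartesianRe (A s)).PosSemidef) →
      Integrable (fun k : ℝ => lchsWeight F k • hamiltonianEvolution A k t) volume ∧
      timeOrderedExp (fun s => -A s) t =
        ∫ k : ℝ, lchsWeight F k • hamiltonianEvolution A k t) := by
  have hΦ : Integrable (generatingFun F) := hF_int.add hF_int'
  have hΦ0 : ∀ x, 0 < x → generatingFun F x = 0 := fun x hx => generatingFun_eq_zero hF_exp hx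
  have hΦ' : Integrable fun x => deriv F x + deriv (deriv F) x := hF_int'.add hF_int''
  have hΦ'0 : ∀ x, 0 < x → deriv F x + deriv (deriv F) x = 0 := fun x hx =>
    deriv_generatingFun_eq_zero hF_exp hF_smooth hx
  have hfc : ContinuousOn (kernelFun F) {z : ℂ | z.im ≤ 0} :=
    continuousOn_const.mul (continuousOn_integral_mul_cexp_I_mul hΦ hΦ0)
  have hfd : DifferentiableOn ℂ (kernelFun F) {z : ℂ | z.im < 0} :=
    (differentiableOn_integral_mul_cexp_I_mul hΦ hΦ0).const_mul _
  set c : ℝ := ‖1 / (2 * (Real.pi : ℂ))‖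
  have hfb : ∀ z : ℂ, z.im ≤ 0 → ‖kernelFun F z‖ ≤ c * ∫ x : ℝ, ‖generatingFun F x‖ := by
    intro z hz
    rw [kernelFun, norm_mul]
    gcongr
    exact norm_integral_mul_cexp_I_mul_le hΦ hΦ0 hz
  have hfb' : ∀ z : ℂ, z.im ≤ 0 →
      ‖z‖ * ‖kernelFun F z‖ ≤ c * ∫ x : ℝ, ‖deriv F x + deriv (deriv F) x‖ := by
    intro z hz
    have h := norm_integral_mul_cexp_I_mul_le hΦ' hΦ'0 hz
    rw [integral_deriv_mul_cexp_I_mul hΦ hΦ0 hΦ' hΦ'0 (hasDerivAt_generatingFun hF_smooth) hz,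
      norm_mul, norm_neg, norm_mul, Complex.norm_I, one_mul] at h
    rw [kernelFun, norm_mul, mul_left_comm]
    gcongr
  obtain ⟨C, hC⟩ : ∃ C : ℝ, ∀ z : ℂ, z.im ≤ 0 → (1 + ‖z‖) * ‖kernelFun F z‖ ≤ C :=
    ⟨_, fun z hz => by rw [add_mul, one_mul]; exact add_le_add (hfb z hz) (hfb' z hz)⟩
  have hfI : (2 * (Real.pi : ℂ)) * kernelFun F (-Complex.I) = 1 := by
    rw [kernelFun_neg_I hF_exp hF_smooth hF_int hF_int', mul_one_div_cancel]
    simp [Real.pi_ne_zero]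
  have hw : ∀ k : ℝ, lchsWeight F k = (1 - Complex.I * (k : ℂ))⁻¹ * kernelFun F k := fun k => by
    rw [lchsWeight, div_eq_inv_mul]
  refine ⟨fun z hz => integrable_mul_cexp_I_mul hΦ hΦ0 hz, hfc,
    hfd.analyticOnNhd (isOpen_lt Complex.continuous_im continuous_const), ⟨_, hfb'⟩, ?_, ?_⟩
  · have h := integrable_and_integral_inv_one_sub_I_mul_smul hfc hfd hC
    simp only [smul_eq_mul, ← hw] at h
    exact ⟨h.1, h.2.trans hfI⟩
  · intro N A t ht hA hpos
    have hL := intervalIntegrable_cartesianRe hA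
    have hH := intervalIntegrable_cartesianIm hA
    set U : ℂ → Matrix (Fin N) (Fin N) ℂ := fun z =>
      timeOrderedExp (fun s => (-Complex.I) • (z • cartesianRe (A s) + cartesianIm (A s))) t
    have hUd : Differentiable ℂ U := by
      have h := differentiable_timeOrderedExp_affine (hL.smul (-Complex.I)) (hH.smul (-Complex.I)) ht
      convert h using 5 with z s
      simp only [Pi.smul_apply]
      rw [smul_add, smul_comm z]
    have hUb : ∀ z : ℂ, z.im ≤ 0 → ‖U z‖ ≤ 1 := fun z hz =>
      norm_timeOrderedExp_le_one (((hL.smul z).add hH).smul (-Complex.I)) ht fun s hs v =>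
        re_inner_toEuclideanCLM_nonpos (hpos s hs) (isHermitian_cartesianIm (A s)) hz v
    have hUI : U (-Complex.I) = timeOrderedExp (fun s => -A s) t := by
      simp only [U]
      congr 1
      funext s
      rw [smul_add, smul_smul, neg_mul_neg, Complex.I_mul_I, neg_one_smul, neg_smul, ← neg_add,
        cartesianRe_add_I_smul_cartesianIm]
    have h := integrable_and_integral_inv_one_sub_I_mul_smul
      (h := fun z => kernelFun F z • U z) (C := C)
      (hfc.smul hUd.continuous.continuousOn) (hfd.smul hUd.differentiableOn) fun z hz => by
        rw [norm_smul, ← mul_assoc]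
        exact (mul_le_of_le_one_right (by positivity) (hUb z hz)).trans (hC z hz)
    simp only [smul_smul, ← hw, hfI, one_smul, hUI] at h
    exact ⟨h.1, h.2.symm⟩
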